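/- Let $q\in\mathbb C$ with $|q|>1$, let $N,p\in\mathbb N=\{0,1,2,\dots\}$ and $\alpha\in\mathbb N$ with $\alpha\ge 1$, and let $F:\mathbb C\times\mathbb C\times\mathbb C^N\to\mathbb C^N$ be analytic at $(0,0,0)$, with $F(0,0,0)=0$ and $D_yF(0,0,0)$ invertible. On formal power series in $(x,\epsilon)$ let $\sigma_{q,x}$ and $d_{q,x}$ act term by term through $\sigma_{q,x}(x^n)=q^nx^n$ and $d_{q,x}(x^n)=\frac{q^n-1}{q-1}x^{n-1}$. Consider each of the two systems $$\epsilon^\alpha x^{p+1}\,d_{q,x}y=F(x,\epsilon,y),\qquad \epsilon^\alpha x^{p}\,\sigma_{q,x}y=F(x,\epsilon,y).$$ Then each system has a unique formal power series solution $\hat y\in\mathbb C[[x,\epsilon]]^N$ with $\hat y(0,0)=0$ (so that $F(x,\epsilon,\hat y)$ is defined by substitution in the Taylor series of $F$ at the origin). Write $$\hat y=\sum_{n\ge0}y_n(\epsilon)x^n=\sum_{n\ge0}u_n(x)\epsilon^n .$$ For $R>0$ let $D_R=\{z\in\mathbb C:|z|<R\}$. 1. If $p>0$, there are $r,C,A>0$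 such that, for all $n\ge0$, the series $y_n$ and $u_n$ converge to bounded holomorphic functions on $D_r$ and on $D_{r/|q|^{\lfloor n/\alpha\rfloor}}$, respectively, defined up to the boundary by their series, with $$\sup_{|\epsilon|\le r}|y_n(\epsilon)|\le CA^n|q|^{\frac{n^2}{2p}},\qquad \sup_{|x|\le r/|q|^{\lfloor n/\alpha\rfloor}}|u_n(x)|\le CA^n .$$ 2. If $p=0$, there are $r,C,A>0$ such that, for all $n\ge0$, the series $y_n$ and $u_n$ converge to bounded holomorphic functions on $D_{r/|q|^{n/\alpha}}$ and on $D_{r/|q|^{\lfloor n/\alpha\rfloor}}$, respectively, defined up to the boundary by their series, with $$\sup_{|\epsilon|\le r/|q|^{n/\alpha}}|y_n(\epsilon)|\le CA^n,\qquad \sup_{|x|\le r/|q|^{\lfloor n/\alpha\rfloor}}|u_n(x)|\le CA^n .$$ The constants $r,C,A$ may depend on $q$, $p$, $\alpha$ and $F$, but not on $n$. -/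

import Mathlib

open scoped BigOperators Nat

noncomputable section

/-- The formal power series ring `ℂ[[x, ε]]`; variable `0` is `x` and variable `1` is `ε`. -/
abbrev FormalSeries : Type := MvPowerSeries (Fin 2) ℂ

/-- The coefficient `a_{n,m}` of `x ^ n * ε ^ m`. -/
def biCoeff (n m : ℕ) (f : FormalSeries) : ℂ :=
  MvPowerSeries.coeff (Finsupp.single 0 n + Finsupp.single 1 m) f

/-- The `q`-number `[n]_q`. -/
def qNumber (q : ℂ) (n : ℕ) : ℂ := (q ^ n - 1) / (q - 1)

/-- `σ_{q,x}`, term by term: `x ^ n ↦ q ^ n * x ^ n`. -/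
def qShift (q : ℂ) (f : FormalSeries) : FormalSeries :=
  fun d => q ^ d 0 * MvPowerSeries.coeff d f

/-- The Jackson derivative `d_{q,x}`, term by term: `x ^ n ↦ [n]_q * x ^ (n - 1)`. -/
def qDeriv (q : ℂ) (f : FormalSeries) : FormalSeries :=
  fun d => qNumber q (d 0 + 1) * MvPowerSeries.coeff (d + Finsupp.single 0 1) f

/-- The standard basis of `ℂ × ℂ × ℂ ^ N`: the directions of `x`, of `ε` and of `y_1, …, y_N`. -/
def stdVec (N : ℕ) : Fin 2 ⊕ Fin N → ℂ × ℂ × (Fin N → ℂ) :=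
  Sum.elim ![(1, 0, 0), (0, 1, 0)] (fun j => (0, 0, Pi.single j 1))

/-- The Taylor series at the origin of a function of `(x, ε, y_1, …, y_N)`. With `n = |d|`, its
coefficient at the multi-index `d` is that of `z ^ d` in the polynomial
`D ^ n f (0) [z, …, z] / n!`, that is, `∂ ^ d f (0) / d!`. -/
def taylorSeries {N : ℕ} (f : ℂ × ℂ × (Fin N → ℂ) → ℂ) : MvPowerSeries (Fin 2 ⊕ Fin N) ℂ :=
  fun d => ((d.degree)! : ℂ)⁻¹ *
    ∑ i : Fin d.degree → Fin 2 ⊕ Fin N,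
      if ∑ k, Finsupp.single (i k) 1 = d then
        iteratedFDeriv ℂ d.degree f 0 (fun k => stdVec N (i k))
      else 0

/-- The `j`-th component of the formal series `F(x, ε, ŷ(x, ε))`: the series `x`, `ε` and
`ŷ_1, …, ŷ_N` are substituted in the Taylor series of `F_j` at the origin.
This is meaningful for `ŷ(0, 0) = 0`. -/
def formalComp {N : ℕ} (F : ℂ × ℂ × (Fin N → ℂ) → (Fin N → ℂ)) (y : Fin N → FormalSeries)
    (j : Fin N) : FormalSeries :=
  MvPowerSeries.subst
    (Sum.elim (fun i : Fin 2 => (MvPowerSeries.X i : FormalSeries)) y)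
    (taylorSeries (fun z => F z j))

/-- `ŷ` is a formal power series solution, with `ŷ(0, 0) = 0`, of
`ε ^ α * x ^ (p + 1) * d_{q,x} y = F(x, ε, y)`. -/
def IsFormalSolutionDeriv {N : ℕ} (q : ℂ) (p α : ℕ)
    (F : ℂ × ℂ × (Fin N → ℂ) → (Fin N → ℂ)) (y : Fin N → FormalSeries) : Prop :=
  (∀ j, MvPowerSeries.constantCoeff (y j) = 0) ∧
  ∀ j, (MvPowerSeries.X 1) ^ α * (MvPowerSeries.X 0) ^ (p + 1) * qDeriv q (y j) = formalComp F y j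

/-- `ŷ` is a formal power series solution, with `ŷ(0, 0) = 0`, of
`ε ^ α * x ^ p * σ_{q,x} y = F(x, ε, y)`. -/
def IsFormalSolutionShift {N : ℕ} (q : ℂ) (p α : ℕ)
    (F : ℂ × ℂ × (Fin N → ℂ) → (Fin N → ℂ)) (y : Fin N → FormalSeries) : Prop :=
  (∀ j, MvPowerSeries.constantCoeff (y j) = 0) ∧
  ∀ j, (MvPowerSeries.X 1) ^ α * (MvPowerSeries.X 0) ^ p * qShift q (y j) = formalComp F y j

/-- The Taylor coefficients of `y_n(ε)`, where `ŷ = ∑ y_n(ε) x ^ n`. -/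
def xCoeff {N : ℕ} (y : Fin N → FormalSeries) (n : ℕ) : ℕ → (Fin N → ℂ) :=
  fun m j => biCoeff n m (y j)

/-- The Taylor coefficients of `u_n(x)`, where `ŷ = ∑ u_n(x) ε ^ n`. -/
def epsCoeff {N : ℕ} (y : Fin N → FormalSeries) (n : ℕ) : ℕ → (Fin N → ℂ) :=
  fun m j => biCoeff m n (y j)

/-- The power series `∑ c_m z ^ m` converges for `|z| ≤ R`, its sum is holomorphic on the open disc
of radius `R`, and the norm of the sum is at most `B` for `|z| ≤ R`. -/
def HolomorphicBoundedBy {N : ℕ} (c : ℕ → (Fin N → ℂ)) (R B : ℝ) : Prop :=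
  ∃ f : ℂ → (Fin N → ℂ),
    DifferentiableOn ℂ f (Metric.ball 0 R) ∧
    ∀ z : ℂ, ‖z‖ ≤ R → HasSum (fun m => z ^ m • c m) (f z) ∧ ‖f z‖ ≤ B

end

/-! Let `B` be the inverse of the Jacobian matrix `A` of `F` in `y`, and write `F = h + A y`, where
`h` has no term linear in `y` alone. Either equation becomes `y = B (x^p ε^α l(y) - h(x, ε, y))`,
where `l` multiplies the coefficient of `x^n ε^m` by `[n]_q` or by `q^n` (`formalEquation_iff`). As
`α ≥ 1` and `y(0,0) = 0`, the coefficients of degree `k` on the right depend only on coefficients of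
`y` of lower degree, so there is exactly one formal fixed point (`existsUnique_implicitStep`).

For the growth, measure a series with coefficients `a_e` by `∑ |a_e| ρ^|e| / w(e)`. If `w ≥ 1` and
`w(e) w(e') ≤ w(e + e')`, this norm is submultiplicative. If moreover `|l(e)| w(e) ≤ K w(s + e)`
with `s = (p, α)`, the term with the unbounded operator `l` has norm at most `K ρ` times that of
`y`. For small `δ`, and then small `ρ`, the ball of radius `δ` is preserved. Running this on
truncations by total degree avoids assuming that the norm is finite, and gives `|a_e| ≤ δ M^|e|
w(e)` (`exists_coeff_bound_of_eq_implicitStep`).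

Two weights suffice: `|q|^(n ⌊m/α⌋)` always, and `|q|^(n²/(2p))` if `p > 0`. Each gains at least a
factor `|q|^n` when `(n, m)` moves by `(p, α)` (`exists_coeff_bounds`). Geometric series turn these
bounds into the estimates on discs. -/

noncomputable section

open scoped ENNReal

/-! ### Weighted coefficient sums and order of contact -/

/-- The sum of the norms of the coefficients of `f`, weighted by `W`. -/
def wsum {σ : Type*} (W : (σ →₀ ℕ) → ℝ≥0∞) (f : MvPowerSeries σ ℂ) : ℝ≥0∞ :=
  ∑' e, ‖MvPowerSeries.coeff e f‖ₑ * W e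

/-- The product of the powers `a s ^ d s`. -/
def seriesMonomial {σ τ : Type*} (a : σ → MvPowerSeries τ ℂ) (d : σ →₀ ℕ) : MvPowerSeries τ ℂ :=
  d.prod fun s n => a s ^ n

/-- `f` and `g` have the same coefficients in degrees less than `k`. -/
def AgreeBelow {τ : Type*} (k : ℕ) (f g : MvPowerSeries τ ℂ) : Prop :=
  ∀ e : τ →₀ ℕ, e.degree < k → MvPowerSeries.coeff e f = MvPowerSeries.coeff e g

section
variable {σ τ : Type*}

/-- Three separate weights, compared only on the supports, allow a product to be cut off at a higher
degree than its factors when these have no constant term. -/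
theorem wsum_mul_le (W U V : (τ →₀ ℕ) → ℝ≥0∞) (f g : MvPowerSeries τ ℂ)
    (h : ∀ e₁ e₂, MvPowerSeries.coeff e₁ f ≠ 0 → MvPowerSeries.coeff e₂ g ≠ 0 →
      W (e₁ + e₂) ≤ U e₁ * V e₂) :
    wsum W (f * g) ≤ wsum U f * wsum V g := by
  classical
  have h1 : ∀ e, ‖MvPowerSeries.coeff e (f * g)‖ₑ * W e ≤
      ∑' p : Finset.HasAntidiagonal.antidiagonal e, (‖MvPowerSeries.coeff p.1.1 f‖ₑ * U p.1.1) *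
        (‖MvPowerSeries.coeff p.1.2 g‖ₑ * V p.1.2) := by
    intro e
    rw [MvPowerSeries.coeff_mul, tsum_fintype]
    refine (mul_le_mul_left (enorm_sum_le _ _) _).trans ?_
    rw [Finset.sum_mul, ← Finset.sum_coe_sort (Finset.HasAntidiagonal.antidiagonal e)]
    refine Finset.sum_le_sum fun p _ => ?_
    rw [enorm_mul]
    by_cases hf : MvPowerSeries.coeff p.1.1 f = 0
    · simp [hf]
    by_cases hg : MvPowerSeries.coeff p.1.2 g = 0
    · simp [hg]
    have h2 := h _ _ hf hg
    rw [Finset.HasAntidiagonal.mem_antidiagonal.1 p.2] at h2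
    calc _ ≤ ‖MvPowerSeries.coeff p.1.1 f‖ₑ * ‖MvPowerSeries.coeff p.1.2 g‖ₑ *
          (U p.1.1 * V p.1.2) := by gcongr
      _ = _ := by ring
  calc wsum W (f * g) ≤ _ := ENNReal.tsum_le_tsum h1
    _ = ∑' x : (Σ e : τ →₀ ℕ, Finset.HasAntidiagonal.antidiagonal e),
        (‖MvPowerSeries.coeff x.2.1.1 f‖ₑ * U x.2.1.1) *
        (‖MvPowerSeries.coeff x.2.1.2 g‖ₑ * V x.2.1.2) := (ENNReal.tsum_sigma'
        (fun x : (Σ e : τ →₀ ℕ, Finset.HasAntidiagonal.antidiagonal e) =>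
          (‖MvPowerSeries.coeff x.2.1.1 f‖ₑ * U x.2.1.1) *
          (‖MvPowerSeries.coeff x.2.1.2 g‖ₑ * V x.2.1.2))).symm
    _ = ∑' p : (τ →₀ ℕ) × (τ →₀ ℕ), (‖MvPowerSeries.coeff p.1 f‖ₑ * U p.1) *
        (‖MvPowerSeries.coeff p.2 g‖ₑ * V p.2) :=
      Finset.HasAntidiagonal.sigmaAntidiagonalEquivProd.tsum_eq
        (fun p : (τ →₀ ℕ) × (τ →₀ ℕ) => (‖MvPowerSeries.coeff p.1 f‖ₑ * U p.1) *
        (‖MvPowerSeries.coeff p.2 g‖ₑ * V p.2))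
    _ = wsum U f * wsum V g := by
      rw [ENNReal.tsum_prod']
      simp_rw [ENNReal.tsum_mul_left, ENNReal.tsum_mul_right]
      rfl

theorem wsum_monomial (W : (τ →₀ ℕ) → ℝ≥0∞) (s : τ →₀ ℕ) (c : ℂ) :
    wsum W (MvPowerSeries.monomial s c) = ‖c‖ₑ * W s := by
  classical
  rw [wsum, tsum_eq_single s]
  · rw [MvPowerSeries.coeff_monomial_same]
  · intro e he
    rw [MvPowerSeries.coeff_monomial_ne he]; simp

theorem wsum_one_le {W : (τ →₀ ℕ) → ℝ≥0∞} (hW0 : W 0 ≤ 1) : wsum W 1 ≤ 1 := by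
  have := wsum_monomial W 0 1
  rw [MvPowerSeries.monomial_zero_one] at this
  simpa [this] using hW0

theorem wsum_add_le (W : (τ →₀ ℕ) → ℝ≥0∞) (f g : MvPowerSeries τ ℂ) :
    wsum W (f + g) ≤ wsum W f + wsum W g := by
  rw [wsum, wsum, wsum, ← ENNReal.tsum_add]
  refine ENNReal.tsum_le_tsum fun e => ?_
  rw [map_add, ← add_mul]
  gcongr
  exact enorm_add_le _ _

theorem wsum_smul (W : (τ →₀ ℕ) → ℝ≥0∞) (c : ℂ) (f : MvPowerSeries τ ℂ) :
    wsum W (c • f) = ‖c‖ₑ * wsum W f := by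
  simp_rw [wsum, map_smul, smul_eq_mul, enorm_mul, mul_assoc, ENNReal.tsum_mul_left]

theorem wsum_sub_le (W : (τ →₀ ℕ) → ℝ≥0∞) (f g : MvPowerSeries τ ℂ) :
    wsum W (f - g) ≤ wsum W f + wsum W g := by
  have := wsum_add_le W f ((-1 : ℂ) • g)
  rw [wsum_smul] at this
  simpa [sub_eq_add_neg] using this

theorem wsum_sum_le {ι : Type*} (W : (τ →₀ ℕ) → ℝ≥0∞) (s : Finset ι)
    (f : ι → MvPowerSeries τ ℂ) : wsum W (∑ i ∈ s, f i) ≤ ∑ i ∈ s, wsum W (f i) := by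
  classical
  induction s using Finset.induction_on with
  | empty => simp [wsum]
  | insert i s hi ih =>
    rw [Finset.sum_insert hi, Finset.sum_insert hi]
    exact (wsum_add_le _ _ _).trans (by gcongr)

theorem enorm_coeff_mul_le_wsum (W : (τ →₀ ℕ) → ℝ≥0∞) (f : MvPowerSeries τ ℂ) (e : τ →₀ ℕ) :
    ‖MvPowerSeries.coeff e f‖ₑ * W e ≤ wsum W f :=
  ENNReal.le_tsum (f := fun e => ‖MvPowerSeries.coeff e f‖ₑ * W e) e

theorem seriesMonomial_zero (a : σ → MvPowerSeries τ ℂ) : seriesMonomial a 0 = 1 := by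
  simp [seriesMonomial]

theorem seriesMonomial_add (a : σ → MvPowerSeries τ ℂ) (d d' : σ →₀ ℕ) :
    seriesMonomial a (d + d') = seriesMonomial a d * seriesMonomial a d' := by
  classical
  exact Finsupp.prod_add_index' (fun s => pow_zero _) (fun s m n => pow_add _ _ _)

theorem seriesMonomial_single (a : σ → MvPowerSeries τ ℂ) (s : σ) (n : ℕ) :
    seriesMonomial a (Finsupp.single s n) = a s ^ n :=
  Finsupp.prod_single_index (pow_zero _)

theorem coeff_zero_seriesMonomial {a : σ → MvPowerSeries τ ℂ}
    (ha : ∀ s, MvPowerSeries.constantCoeff (a s) = 0) {d : σ →₀ ℕ} (hd : d ≠ 0) :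
    MvPowerSeries.coeff 0 (seriesMonomial a d) = 0 := by
  rw [MvPowerSeries.coeff_zero_eq_constantCoeff_apply]
  obtain ⟨s, hs⟩ := Finsupp.ne_iff.1 hd
  have h : d = Finsupp.single s 1 + (d - Finsupp.single s 1) := by
    rw [add_tsub_cancel_of_le]
    simpa [Nat.one_le_iff_ne_zero] using hs
  rw [h, seriesMonomial_add, seriesMonomial_single, pow_one, map_mul, ha, zero_mul]

theorem wsum_seriesMonomial_le {W : (τ →₀ ℕ) → ℝ≥0∞} (hW0 : W 0 ≤ 1)
    (hW : ∀ e₁ e₂, W (e₁ + e₂) ≤ W e₁ * W e₂) {a : σ → MvPowerSeries τ ℂ} {t : ℝ≥0∞}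
    (ha : ∀ s, wsum W (a s) ≤ t) (d : σ →₀ ℕ) :
    wsum W (seriesMonomial a d) ≤ t ^ d.degree := by
  induction d using Finsupp.induction_linear with
  | zero => simpa [seriesMonomial_zero] using wsum_one_le hW0
  | add d d' h h' =>
    rw [seriesMonomial_add, map_add, pow_add]
    exact (wsum_mul_le W W W _ _ fun _ _ _ _ => hW _ _).trans (by gcongr)
  | single s n =>
    rw [seriesMonomial_single, Finsupp.degree_single]
    induction n with
    | zero => simpa using wsum_one_le hW0
    | succ n ih =>
      rw [pow_succ, pow_succ]
      exact (wsum_mul_le W W W _ _ fun _ _ _ _ => hW _ _).trans (by gcongr; exact ha s)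

theorem exists_add_of_two_le_degree {d : σ →₀ ℕ} (hd : 2 ≤ d.degree) :
    ∃ d₁ d₂ : σ →₀ ℕ, d₁ ≠ 0 ∧ d₂ ≠ 0 ∧ d = d₁ + d₂ := by
  have h0 : d ≠ 0 := by rintro rfl; simp at hd
  obtain ⟨s, hs⟩ := Finsupp.ne_iff.1 h0
  have h : Finsupp.single s 1 + (d - Finsupp.single s 1) = d := by
    rw [add_tsub_cancel_of_le]
    simpa [Nat.one_le_iff_ne_zero] using hs
  refine ⟨_, _, by simp, ?_, h.symm⟩
  intro h2
  rw [h2, add_zero] at h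
  rw [← h, Finsupp.degree_single] at hd
  omega

/-- Splitting the monomial into two nontrivial ones gives factors without constant term, so `W'`
need only be compared with `W` at sums of nonzero exponents. -/
theorem wsum_seriesMonomial_le_of_two_le_degree {W' W : (τ →₀ ℕ) → ℝ≥0∞} (hW0 : W 0 ≤ 1)
    (hW : ∀ e₁ e₂, W (e₁ + e₂) ≤ W e₁ * W e₂)
    (hW' : ∀ e₁ e₂, e₁ ≠ 0 → e₂ ≠ 0 → W' (e₁ + e₂) ≤ W e₁ * W e₂)
    {a : σ → MvPowerSeries τ ℂ} (ha0 : ∀ s, MvPowerSeries.constantCoeff (a s) = 0) {t : ℝ≥0∞}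
    (ha : ∀ s, wsum W (a s) ≤ t) {d : σ →₀ ℕ} (hd : 2 ≤ d.degree) :
    wsum W' (seriesMonomial a d) ≤ t ^ d.degree := by
  obtain ⟨d₁, d₂, h₁, h₂, rfl⟩ := exists_add_of_two_le_degree hd
  rw [seriesMonomial_add, map_add, pow_add]
  refine (wsum_mul_le W' W W _ _ fun e₁ e₂ he₁ he₂ => hW' _ _ ?_ ?_).trans
    (mul_le_mul' (wsum_seriesMonomial_le hW0 hW ha d₁) (wsum_seriesMonomial_le hW0 hW ha d₂))
  · rintro rfl; exact he₁ (coeff_zero_seriesMonomial ha0 h₁)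
  · rintro rfl; exact he₂ (coeff_zero_seriesMonomial ha0 h₂)

theorem wsum_subst_le [Finite σ] (W : (τ →₀ ℕ) → ℝ≥0∞) {a : σ → MvPowerSeries τ ℂ}
    (ha : ∀ s, MvPowerSeries.constantCoeff (a s) = 0) (f : MvPowerSeries σ ℂ) :
    wsum W (MvPowerSeries.subst a f) ≤
      ∑' d, ‖MvPowerSeries.coeff d f‖ₑ * wsum W (seriesMonomial a d) := by
  have hs := MvPowerSeries.hasSubst_of_constantCoeff_zero ha
  have h1 : ∀ e, ‖MvPowerSeries.coeff e (MvPowerSeries.subst a f)‖ₑ * W e ≤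
      ∑' d, ‖MvPowerSeries.coeff d f‖ₑ *
        (‖MvPowerSeries.coeff e (seriesMonomial a d)‖ₑ * W e) := by
    intro e
    rw [MvPowerSeries.coeff_subst hs,
      finsum_eq_sum _ (MvPowerSeries.coeff_subst_finite hs f e)]
    refine (mul_le_mul_left (enorm_sum_le _ _) _).trans ?_
    rw [Finset.sum_mul]
    refine le_trans (le_of_eq (Finset.sum_congr rfl fun d _ => ?_)) (ENNReal.sum_le_tsum _)
    rw [smul_eq_mul, enorm_mul, mul_assoc]; rfl
  refine (ENNReal.tsum_le_tsum h1).trans ?_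
  rw [ENNReal.tsum_comm]
  simp_rw [ENNReal.tsum_mul_left]
  rfl

theorem AgreeBelow.mul {k : ℕ} {f f' g g' : MvPowerSeries τ ℂ} (hf : AgreeBelow k f f')
    (hg : AgreeBelow k g g') : AgreeBelow k (f * g) (f' * g') := by
  classical
  intro e he
  rw [MvPowerSeries.coeff_mul, MvPowerSeries.coeff_mul]
  refine Finset.sum_congr rfl fun p hp => ?_
  have := congrArg Finsupp.degree (Finset.HasAntidiagonal.mem_antidiagonal.1 hp)
  rw [map_add] at this
  rw [hf _ (by omega), hg _ (by omega)]

/-- In degree `k`, both exponents of a contributing pair are nonzero, hence both have degree less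
than `k`. -/
theorem AgreeBelow.mul_of_coeff_zero {k : ℕ} {f f' g g' : MvPowerSeries τ ℂ}
    (hf : AgreeBelow k f f') (hg : AgreeBelow k g g')
    (hf0 : MvPowerSeries.coeff 0 f = 0) (hf0' : MvPowerSeries.coeff 0 f' = 0)
    (hg0 : MvPowerSeries.coeff 0 g = 0) (hg0' : MvPowerSeries.coeff 0 g' = 0) :
    AgreeBelow (k + 1) (f * g) (f' * g') := by
  classical
  intro e he
  rw [MvPowerSeries.coeff_mul, MvPowerSeries.coeff_mul]
  refine Finset.sum_congr rfl fun p hp => ?_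
  have := congrArg Finsupp.degree (Finset.HasAntidiagonal.mem_antidiagonal.1 hp)
  rw [map_add] at this
  by_cases h1 : p.1 = 0
  · rw [h1, hf0, hf0', zero_mul, zero_mul]
  by_cases h2 : p.2 = 0
  · rw [h2, hg0, hg0', mul_zero, mul_zero]
  have h1' := mt (Finsupp.degree_eq_zero_iff _).1 h1
  have h2' := mt (Finsupp.degree_eq_zero_iff _).1 h2
  rw [hf _ (by omega), hg _ (by omega)]

theorem agreeBelow_seriesMonomial {k : ℕ} {a b : σ → MvPowerSeries τ ℂ}
    (h : ∀ s, AgreeBelow k (a s) (b s)) (d : σ →₀ ℕ) :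
    AgreeBelow k (seriesMonomial a d) (seriesMonomial b d) := by
  induction d using Finsupp.induction_linear with
  | zero => intro e _; rw [seriesMonomial_zero, seriesMonomial_zero]
  | add d d' h h' => rw [seriesMonomial_add, seriesMonomial_add]; exact h.mul h'
  | single s n =>
    rw [seriesMonomial_single, seriesMonomial_single]
    induction n with
    | zero => intro e _; simp
    | succ n ih => rw [pow_succ, pow_succ]; exact ih.mul (h s)

theorem agreeBelow_seriesMonomial_of_two_le_degree {k : ℕ} {a b : σ → MvPowerSeries τ ℂ}
    (ha : ∀ s, MvPowerSeries.constantCoeff (a s) = 0)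
    (hb : ∀ s, MvPowerSeries.constantCoeff (b s) = 0)
    (h : ∀ s, AgreeBelow k (a s) (b s)) {d : σ →₀ ℕ} (hd : 2 ≤ d.degree) :
    AgreeBelow (k + 1) (seriesMonomial a d) (seriesMonomial b d) := by
  obtain ⟨d₁, d₂, h₁, h₂, rfl⟩ := exists_add_of_two_le_degree hd
  rw [seriesMonomial_add, seriesMonomial_add]
  exact (agreeBelow_seriesMonomial h d₁).mul_of_coeff_zero (agreeBelow_seriesMonomial h d₂)
    (coeff_zero_seriesMonomial ha h₁) (coeff_zero_seriesMonomial hb h₁)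
    (coeff_zero_seriesMonomial ha h₂) (coeff_zero_seriesMonomial hb h₂)

end

/-! ### Taylor coefficients of an analytic function -/

section
variable {N : ℕ}

theorem norm_stdVec_le (i : Fin 2 ⊕ Fin N) : ‖stdVec N i‖ ≤ 1 := by
  rcases i with i | j
  · fin_cases i <;> simp [stdVec, Prod.norm_def]
  · simp [stdVec, Prod.norm_def, Pi.norm_single]

/-- The `n`-th derivative is the sum of the `n`-th term of the power series over the `n!`
permutations of its arguments, and these terms grow at most geometrically. -/
theorem AnalyticAt.exists_norm_iteratedFDeriv_le {E G : Type*} [NormedAddCommGroup E]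
    [NormedSpace ℂ E] [NormedAddCommGroup G] [NormedSpace ℂ G] [CompleteSpace G] {f : E → G}
    {x : E} (hf : AnalyticAt ℂ f x) :
    ∃ C > (0 : ℝ), ∃ R > (0 : ℝ), ∀ (n : ℕ) (v : Fin n → E), (∀ k, ‖v k‖ ≤ 1) →
      ‖iteratedFDeriv ℂ n f x v‖ ≤ n ! * (C * R ^ n) := by
  obtain ⟨p, r, hp⟩ := hf
  obtain ⟨C, R, hC, hR, h⟩ := p.le_mul_pow_of_radius_pos (hp.r_pos.trans_le hp.r_le)
  refine ⟨C, hC, R, hR, fun n v hv => ?_⟩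
  rw [hp.iteratedFDeriv_eq_sum_of_completeSpace]
  refine (norm_sum_le _ _).trans ?_
  have h1 : ∀ σ ∈ (Finset.univ : Finset (Equiv.Perm (Fin n))),
      ‖p n (fun i => v (σ i))‖ ≤ C * R ^ n := by
    intro σ _
    have h2 := (p n).le_opNorm (fun i => v (σ i))
    have h3 : ∏ i, ‖v (σ i)‖ ≤ 1 := Finset.prod_le_one (fun _ _ => norm_nonneg _) fun i _ => hv _
    calc _ ≤ ‖p n‖ * ∏ i, ‖v (σ i)‖ := h2
      _ ≤ ‖p n‖ * 1 := by gcongr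
      _ ≤ _ := by rw [mul_one]; exact h n
  refine (Finset.sum_le_card_nsmul _ _ _ h1).trans ?_
  simp [Fintype.card_perm]

theorem coeff_taylorSeries (f : ℂ × ℂ × (Fin N → ℂ) → ℂ) {d : Fin 2 ⊕ Fin N →₀ ℕ} {n : ℕ}
    (h : d.degree = n) :
    MvPowerSeries.coeff d (taylorSeries f) = ((n)! : ℂ)⁻¹ *
    ∑ i : Fin n → Fin 2 ⊕ Fin N,
      if ∑ k, Finsupp.single (i k) 1 = d then
        iteratedFDeriv ℂ n f 0 (fun k => stdVec N (i k))
      else 0 := by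
  subst h; rfl

theorem coeff_zero_taylorSeries (f : ℂ × ℂ × (Fin N → ℂ) → ℂ) :
    MvPowerSeries.coeff 0 (taylorSeries f) = f 0 := by
  rw [coeff_taylorSeries f (n := 0) (by simp)]
  simp

theorem coeff_single_taylorSeries (f : ℂ × ℂ × (Fin N → ℂ) → ℂ) (s : Fin 2 ⊕ Fin N) :
    MvPowerSeries.coeff (Finsupp.single s 1) (taylorSeries f) = fderiv ℂ f 0 (stdVec N s) := by
  rw [coeff_taylorSeries f (n := 1) (by simp)]
  rw [← (Equiv.funUnique (Fin 1) (Fin 2 ⊕ Fin N)).symm.sum_comp, Finset.sum_eq_single s]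
  · simp [iteratedFDeriv_one_apply]
  · intro b _ hb
    simp [Finsupp.single_left_inj, hb]
  · simp

/-- Each of the `(2 + N)^n` words of length `n` in the basis directions contributes to a single
multi-index, and by at most `C R^n`. -/
theorem tsum_enorm_coeff_taylorSeries_le (f : ℂ × ℂ × (Fin N → ℂ) → ℂ) {C R : ℝ}
    (h : ∀ (n : ℕ) (v : Fin n → ℂ × ℂ × (Fin N → ℂ)), (∀ k, ‖v k‖ ≤ 1) →
      ‖iteratedFDeriv ℂ n f 0 v‖ ≤ n ! * (C * R ^ n)) (n : ℕ) :
    ∑' d : Fin 2 ⊕ Fin N →₀ ℕ, (if d.degree = n then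
      ‖MvPowerSeries.coeff d (taylorSeries f)‖ₑ else 0) ≤
      ENNReal.ofReal (C * ((2 + N : ℕ) * R) ^ n) := by
  classical
  have h1 : ∀ d : Fin 2 ⊕ Fin N →₀ ℕ,
      (if d.degree = n then ‖MvPowerSeries.coeff d (taylorSeries f)‖ₑ else 0) ≤
      ∑ i : Fin n → Fin 2 ⊕ Fin N, if d = ∑ k, Finsupp.single (i k) 1 then
        ENNReal.ofReal (C * R ^ n) else 0 := by
    intro d
    split_ifs with hd
    · rw [coeff_taylorSeries f hd, Finset.mul_sum]
      refine (enorm_sum_le _ _).trans (Finset.sum_le_sum fun i _ => ?_)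
      simp only [eq_comm (a := d)]
      split_ifs with hi
      · rw [← ofReal_norm]
        apply ENNReal.ofReal_le_ofReal
        rw [norm_mul, norm_inv, Complex.norm_natCast]
        have h2 := h n (fun k => stdVec N (i k)) (fun k => norm_stdVec_le _)
        have h3 : (0 : ℝ) < n ! := by exact_mod_cast Nat.factorial_pos n
        rw [inv_mul_le_iff₀ h3]
        exact h2
      · simp
    · exact zero_le
  refine (ENNReal.tsum_le_tsum h1).trans ?_
  rw [Summable.tsum_finsetSum (fun _ _ => ENNReal.summable)]
  simp_rw [tsum_ite_eq]
  rw [Finset.sum_const, Finset.card_univ, Fintype.card_fun, nsmul_eq_mul]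
  simp only [Fintype.card_sum, Fintype.card_fin]
  rw [← ENNReal.ofReal_natCast, ← ENNReal.ofReal_mul (by positivity)]
  apply le_of_eq
  congr 1
  rw [mul_pow]
  push_cast
  ring
end

/-! ### Formal fixed points -/

section
variable {ι τ : Type*}

/-- A map on tuples of power series without constant term that gains one order of contact
has a unique fixed point. -/
theorem existsUnique_fixedPoint_of_agreeBelow
    (Φ : (ι → MvPowerSeries τ ℂ) → (ι → MvPowerSeries τ ℂ))
    (h0 : ∀ y, (∀ i, MvPowerSeries.constantCoeff (y i) = 0) →
      ∀ i, MvPowerSeries.constantCoeff (Φ y i) = 0)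
    (hΦ : ∀ k y y', (∀ i, MvPowerSeries.constantCoeff (y i) = 0) →
      (∀ i, MvPowerSeries.constantCoeff (y' i) = 0) → (∀ i, AgreeBelow k (y i) (y' i)) →
      ∀ i, AgreeBelow (k + 1) (Φ y i) (Φ y' i)) :
    ∃! y, (∀ i, MvPowerSeries.constantCoeff (y i) = 0) ∧ y = Φ y := by
  set Y : ℕ → ι → MvPowerSeries τ ℂ := fun k => Φ^[k] 0 with hY
  have hYs : ∀ k, Y (k + 1) = Φ (Y k) := fun k => Function.iterate_succ_apply' Φ k 0
  have hY0 : ∀ k i, MvPowerSeries.constantCoeff (Y k i) = 0 := by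
    intro k
    induction k with
    | zero => intro i; simp [hY]
    | succ k ih => rw [hYs]; exact h0 _ ih
  have hstep : ∀ k i, AgreeBelow k (Y k i) (Y (k + 1) i) := by
    intro k
    induction k with
    | zero => intro i e he; omega
    | succ k ih => rw [hYs (k + 1), hYs k]; exact hΦ _ _ _ (hY0 _) (hYs k ▸ hY0 _) (hYs k ▸ ih)
  have hle : ∀ k m, k ≤ m → ∀ i, AgreeBelow k (Y k i) (Y m i) := by
    intro k m hkm i
    induction m, hkm using Nat.le_induction with
    | base => intro e _; rfl
    | succ m hm ih => intro e he; rw [ih e he, hstep m i e (by omega)]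
  -- The iterates stabilise: coefficients of degree `d` no longer change from iterate `d + 1` on.
  set y : ι → MvPowerSeries τ ℂ :=
    fun i e => MvPowerSeries.coeff e (Y (e.degree + 1) i) with hy
  have hyY : ∀ k i, AgreeBelow k (y i) (Y k i) := fun k i e he =>
    hle _ _ (by omega) i e (by omega)
  have hy0 : ∀ i, MvPowerSeries.constantCoeff (y i) = 0 := by
    intro i
    rw [← MvPowerSeries.coeff_zero_eq_constantCoeff_apply, hyY 1 i 0 (by simp),
      MvPowerSeries.coeff_zero_eq_constantCoeff_apply, hY0]
  refine ⟨y, ⟨hy0, ?_⟩, ?_⟩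
  · funext i
    ext e
    rw [hΦ e.degree y (Y e.degree) hy0 (hY0 _) (hyY _) i e (by omega), ← hYs,
      hyY (e.degree + 1) i e (by omega)]
  · rintro z ⟨hz0, hz⟩
    have h : ∀ k i, AgreeBelow k (z i) (Y k i) := by
      intro k
      induction k with
      | zero => intro i e he; omega
      | succ k ih =>
        intro i
        rw [hYs, hz]
        exact hΦ k _ _ hz0 (hY0 k) ih i
    funext i
    ext e
    rw [h (e.degree + 1) i e (by omega), hyY (e.degree + 1) i e (by omega)]

/-- The operator that multiplies the coefficient at `e` by `l e`. -/
def diagOp (l : (τ →₀ ℕ) → ℂ) (f : MvPowerSeries τ ℂ) : MvPowerSeries τ ℂ :=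
  fun e => l e * MvPowerSeries.coeff e f

theorem coeff_diagOp (l : (τ →₀ ℕ) → ℂ) (f : MvPowerSeries τ ℂ) (e : τ →₀ ℕ) :
    MvPowerSeries.coeff e (diagOp l f) = l e * MvPowerSeries.coeff e f := rfl

end

/-! ### The fixed-point equation: existence and uniqueness -/

section
variable {N : ℕ}

/-- The series `x`, `ε`, `y_1, …, y_N`. -/
def substArgs (y : Fin N → FormalSeries) : Fin 2 ⊕ Fin N → FormalSeries :=
  Sum.elim (fun i : Fin 2 => (MvPowerSeries.X i : FormalSeries)) y

theorem constantCoeff_substArgs {y : Fin N → FormalSeries}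
    (hy : ∀ i, MvPowerSeries.constantCoeff (y i) = 0) (s : Fin 2 ⊕ Fin N) :
    MvPowerSeries.constantCoeff (substArgs y s) = 0 := by
  rcases s with i | i
  · simp [substArgs]
  · exact hy i

/-- The right-hand side of the equation solved for its linear part in `y`. -/
def implicitStep (B : Matrix (Fin N) (Fin N) ℂ) (l : (Fin 2 →₀ ℕ) → ℂ) (s : Fin 2 →₀ ℕ)
    (h : Fin N → MvPowerSeries (Fin 2 ⊕ Fin N) ℂ) (y : Fin N → FormalSeries) :
    Fin N → FormalSeries :=
  fun i => ∑ j, B i j • (MvPowerSeries.monomial s 1 * diagOp l (y j) -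
    MvPowerSeries.subst (substArgs y) (h j))

theorem eq_single_of_degree_eq_one {σ : Type*} {d : σ →₀ ℕ} (hd : d.degree = 1) :
    ∃ i, d = Finsupp.single i 1 := by
  have : d ∈ {d : σ →₀ ℕ | d.degree = 1} := hd
  rw [← Finsupp.range_single_one] at this
  obtain ⟨i, hi⟩ := this
  exact ⟨i, hi.symm⟩

/-- Monomials of degree at least two gain one order of contact. Among the linear ones only `x` and
`ε` occur, and they do not depend on `y`. -/
theorem agreeBelow_subst {k : ℕ} {h : MvPowerSeries (Fin 2 ⊕ Fin N) ℂ}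
    (hlin : ∀ i : Fin N, MvPowerSeries.coeff (Finsupp.single (Sum.inr i) 1) h = 0)
    {y y' : Fin N → FormalSeries} (hy : ∀ i, MvPowerSeries.constantCoeff (y i) = 0)
    (hy' : ∀ i, MvPowerSeries.constantCoeff (y' i) = 0)
    (hyy' : ∀ i, AgreeBelow k (y i) (y' i)) :
    AgreeBelow (k + 1) (MvPowerSeries.subst (substArgs y) h)
      (MvPowerSeries.subst (substArgs y') h) := by
  have ha := constantCoeff_substArgs hy
  have ha' := constantCoeff_substArgs hy'
  have hag : ∀ s, AgreeBelow k (substArgs y s) (substArgs y' s) := by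
    rintro (i | i)
    · intro e _; rfl
    · exact hyy' i
  intro e he
  rw [MvPowerSeries.coeff_subst (MvPowerSeries.hasSubst_of_constantCoeff_zero ha),
    MvPowerSeries.coeff_subst (MvPowerSeries.hasSubst_of_constantCoeff_zero ha')]
  refine finsum_congr fun d => ?_
  change _ • MvPowerSeries.coeff e (seriesMonomial _ d) =
    _ • MvPowerSeries.coeff e (seriesMonomial _ d)
  rcases Nat.lt_or_ge d.degree 2 with hd | hd
  · rcases Nat.lt_or_ge d.degree 1 with hd0 | hd1
    · have : d = 0 := (Finsupp.degree_eq_zero_iff d).1 (by omega)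
      rw [this, seriesMonomial_zero, seriesMonomial_zero]
    · obtain ⟨i, rfl⟩ := eq_single_of_degree_eq_one (d := d) (by omega)
      rcases i with i | i
      · rw [seriesMonomial_single, seriesMonomial_single]; rfl
      · rw [hlin, zero_smul, zero_smul]
  · rw [agreeBelow_seriesMonomial_of_two_le_degree ha ha' hag hd e he]

theorem agreeBelow_implicitStep {k : ℕ} (B : Matrix (Fin N) (Fin N) ℂ) (l : (Fin 2 →₀ ℕ) → ℂ)
    {s : Fin 2 →₀ ℕ} (hs : s ≠ 0) {h : Fin N → MvPowerSeries (Fin 2 ⊕ Fin N) ℂ}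
    (hlin : ∀ i j : Fin N, MvPowerSeries.coeff (Finsupp.single (Sum.inr i) 1) (h j) = 0)
    {y y' : Fin N → FormalSeries} (hy : ∀ i, MvPowerSeries.constantCoeff (y i) = 0)
    (hy' : ∀ i, MvPowerSeries.constantCoeff (y' i) = 0)
    (hyy' : ∀ i, AgreeBelow k (y i) (y' i)) (i : Fin N) :
    AgreeBelow (k + 1) (implicitStep B l s h y i) (implicitStep B l s h y' i) := by
  intro e he
  simp only [implicitStep, map_sum, map_smul, map_sub]
  refine Finset.sum_congr rfl fun j _ => ?_
  rw [agreeBelow_subst (fun i => hlin i j) hy hy' hyy' e he, MvPowerSeries.coeff_monomial_mul,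
    MvPowerSeries.coeff_monomial_mul]
  split_ifs with hse
  · have h1 : (e - s).degree < k := by
      have h2 := congrArg Finsupp.degree (add_tsub_cancel_of_le hse)
      rw [map_add] at h2
      have h3 := mt (Finsupp.degree_eq_zero_iff s).1 hs
      omega
    rw [coeff_diagOp, coeff_diagOp, hyy' j _ h1]
  · rfl

theorem constantCoeff_implicitStep (B : Matrix (Fin N) (Fin N) ℂ) (l : (Fin 2 →₀ ℕ) → ℂ)
    {s : Fin 2 →₀ ℕ} (hs : s ≠ 0) {h : Fin N → MvPowerSeries (Fin 2 ⊕ Fin N) ℂ}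
    (h0 : ∀ j, MvPowerSeries.coeff 0 (h j) = 0)
    {y : Fin N → FormalSeries} (hy : ∀ i, MvPowerSeries.constantCoeff (y i) = 0) (i : Fin N) :
    MvPowerSeries.constantCoeff (implicitStep B l s h y i) = 0 := by
  have ha := constantCoeff_substArgs hy
  have h1 : ∀ j, MvPowerSeries.coeff 0 (MvPowerSeries.subst (substArgs y) (h j)) = 0 := fun j => by
    rw [MvPowerSeries.coeff_zero_eq_constantCoeff_apply]
    exact MvPowerSeries.constantCoeff_subst_eq_zero
      (MvPowerSeries.hasSubst_of_constantCoeff_zero ha) ha (h0 j)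
  rw [← MvPowerSeries.coeff_zero_eq_constantCoeff_apply]
  simp only [implicitStep, map_sum, map_smul, map_sub, h1, MvPowerSeries.coeff_monomial_mul]
  simp [hs]

theorem existsUnique_implicitStep (B : Matrix (Fin N) (Fin N) ℂ) (l : (Fin 2 →₀ ℕ) → ℂ)
    {s : Fin 2 →₀ ℕ} (hs : s ≠ 0) {h : Fin N → MvPowerSeries (Fin 2 ⊕ Fin N) ℂ}
    (h0 : ∀ j, MvPowerSeries.coeff 0 (h j) = 0)
    (hlin : ∀ i j : Fin N, MvPowerSeries.coeff (Finsupp.single (Sum.inr i) 1) (h j) = 0) :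
    ∃! y : Fin N → FormalSeries, (∀ i, MvPowerSeries.constantCoeff (y i) = 0) ∧
      y = implicitStep B l s h y :=
  existsUnique_fixedPoint_of_agreeBelow _
    (fun _ hy => constantCoeff_implicitStep B l hs h0 hy)
    (fun _ _ _ hy hy' hyy' => agreeBelow_implicitStep B l hs hlin hy hy' hyy')

/-! ### The majorant estimate -/

/-- The weight `ρ ^ |e| / w e`, cut off in degrees greater than `k`. -/
def cutWeight (ρ : ℝ) (w : (Fin 2 →₀ ℕ) → ℝ) (k : ℕ) (e : Fin 2 →₀ ℕ) : ℝ≥0∞ :=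
  if e.degree ≤ k then ENNReal.ofReal (ρ ^ e.degree / w e) else 0

section
variable {ρ : ℝ} {w : (Fin 2 →₀ ℕ) → ℝ} (hρ : 0 < ρ) (hw1 : ∀ e, 1 ≤ w e)
  (hw : ∀ e e', w e * w e' ≤ w (e + e'))

include hρ hw1 in
theorem cutWeight_le (k : ℕ) (e : Fin 2 →₀ ℕ) :
    cutWeight ρ w k e ≤ ENNReal.ofReal (ρ ^ e.degree) := by
  rw [cutWeight]
  split_ifs
  · exact ENNReal.ofReal_le_ofReal (div_le_self (by positivity) (hw1 e))
  · exact zero_le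

include hρ hw1 hw in
theorem cutWeight_add_le {k k' : ℕ} (e e' : Fin 2 →₀ ℕ)
    (hk : (e + e').degree ≤ k' → e.degree ≤ k ∧ e'.degree ≤ k) :
    cutWeight ρ w k' (e + e') ≤ cutWeight ρ w k e * cutWeight ρ w k e' := by
  have h1 := fun e => zero_lt_one.trans_le (hw1 e)
  rw [cutWeight]
  split_ifs with h
  · obtain ⟨ha, hb⟩ := hk h
    rw [cutWeight, cutWeight, if_pos ha, if_pos hb,
      ← ENNReal.ofReal_mul (div_nonneg (by positivity) (h1 e).le)]
    apply ENNReal.ofReal_le_ofReal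
    rw [div_mul_div_comm, map_add, pow_add]
    exact div_le_div_of_nonneg_left (by positivity) (mul_pos (h1 e) (h1 e')) (hw e e')
  · exact zero_le

-- The growth of `l` is absorbed by the growth of `w` under the shift by `s`. The remaining factor
-- `ρ` comes from `|s| ≥ 1`, which also accounts for the step from `k` to `k + 1`.
include hρ hw1 in
theorem wsum_monomial_mul_diagOp_le (hρ1 : ρ ≤ 1) {K : ℝ} (hK : 0 ≤ K) {l : (Fin 2 →₀ ℕ) → ℂ}
    {s : Fin 2 →₀ ℕ} (hs : s ≠ 0) (hl : ∀ e, ‖l e‖ * w e ≤ K * w (s + e)) (k : ℕ)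
    (f : FormalSeries) :
    wsum (cutWeight ρ w (k + 1)) (MvPowerSeries.monomial s 1 * diagOp l f) ≤
      ENNReal.ofReal (K * ρ) * wsum (cutWeight ρ w k) f := by
  classical
  have h1 := fun e => zero_lt_one.trans_le (hw1 e)
  have hsd : 1 ≤ s.degree := Nat.one_le_iff_ne_zero.2 (mt (Finsupp.degree_eq_zero_iff s).1 hs)
  refine (wsum_mul_le _ (fun _ => 1) (fun e => cutWeight ρ w (k + 1) (s + e)) _ _ ?_).trans ?_
  · intro e₁ e₂ he₁ _
    have : e₁ = s := by
      by_contra hne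
      exact he₁ (MvPowerSeries.coeff_monomial_ne hne _)
    rw [this, one_mul]
  · rw [wsum_monomial]
    simp only [enorm_one, one_mul]
    rw [wsum, wsum, ← ENNReal.tsum_mul_left]
    refine ENNReal.tsum_le_tsum fun e => ?_
    suffices hle : ‖l e‖ₑ * cutWeight ρ w (k + 1) (s + e) ≤
        ENNReal.ofReal (K * ρ) * cutWeight ρ w k e by
      rw [coeff_diagOp, enorm_mul]
      calc _ = ‖MvPowerSeries.coeff e f‖ₑ * (‖l e‖ₑ * cutWeight ρ w (k + 1) (s + e)) := by ring
        _ ≤ ‖MvPowerSeries.coeff e f‖ₑ * (ENNReal.ofReal (K * ρ) * cutWeight ρ w k e) :=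
          mul_le_mul_right hle _
        _ = _ := by ring
    simp only [cutWeight, map_add]
    split_ifs with h h'
    · rw [← ofReal_norm, ← ENNReal.ofReal_mul (norm_nonneg _),
        ← ENNReal.ofReal_mul (by positivity)]
      apply ENNReal.ofReal_le_ofReal
      rw [← mul_div_assoc, ← mul_div_assoc, div_le_div_iff₀ (h1 _) (h1 _)]
      have h2 : ρ ^ (s.degree + e.degree) ≤ ρ * ρ ^ e.degree := by
        rw [pow_add]
        gcongr
        exact pow_le_of_le_one hρ.le hρ1 (by omega)
      calc ‖l e‖ * ρ ^ (s.degree + e.degree) * w e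
          = (‖l e‖ * w e) * ρ ^ (s.degree + e.degree) := by ring
        _ ≤ (K * w (s + e)) * (ρ * ρ ^ e.degree) :=
          mul_le_mul (hl e) h2 (by positivity) (mul_nonneg hK (h1 _).le)
        _ = _ := by ring
    · omega
    · simp
    · simp

-- The linear terms in `x` and `ε` give `C R ρ`. Those of degree at least two are dominated by `∑ C
-- (R δ)^n` over `n ≥ 2`, at most twice its first term as `R δ ≤ 1/2`; they see only degrees up to
-- `k` of `y`, which closes the induction on `k`.
include hρ hw1 hw in
theorem wsum_subst_cutWeight_le {h : MvPowerSeries (Fin 2 ⊕ Fin N) ℂ} {C R : ℝ} (hC : 0 < C)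
    (hR : 0 < R) (h0 : MvPowerSeries.coeff 0 h = 0)
    (hlin : ∀ i : Fin N, MvPowerSeries.coeff (Finsupp.single (Sum.inr i) 1) h = 0)
    (hh : ∀ n, ∑' d, (if d.degree = n then ‖MvPowerSeries.coeff d h‖ₑ else 0) ≤
      ENNReal.ofReal (C * R ^ n))
    {δ : ℝ} (hδ : 0 < δ) (hρδ : ρ ≤ δ) (hRδ : R * δ ≤ 1 / 2) {k : ℕ}
    {y : Fin N → FormalSeries} (hy : ∀ i, MvPowerSeries.constantCoeff (y i) = 0)
    (hyk : ∀ i, wsum (cutWeight ρ w k) (y i) ≤ ENNReal.ofReal δ) :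
    wsum (cutWeight ρ w (k + 1)) (MvPowerSeries.subst (substArgs y) h) ≤
      ENNReal.ofReal (C * R * ρ + 2 * (C * (R * δ) ^ 2)) := by
  classical
  have ha := constantCoeff_substArgs hy
  have hX : ∀ k (i : Fin 2), wsum (cutWeight ρ w k) (MvPowerSeries.X i) ≤ ENNReal.ofReal ρ := by
    intro k i
    rw [MvPowerSeries.X, wsum_monomial]
    simpa using cutWeight_le hρ hw1 k (Finsupp.single i 1)
  have hak : ∀ s, wsum (cutWeight ρ w k) (substArgs y s) ≤ ENNReal.ofReal δ := by
    rintro (i | i)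
    · exact (hX k i).trans (ENNReal.ofReal_le_ofReal hρδ)
    · exact hyk i
  have hW0 : cutWeight ρ w k 0 ≤ 1 := by simpa using cutWeight_le hρ hw1 k 0
  set g : ℕ → ℝ≥0∞ := fun n =>
    if n = 0 then 0 else if n = 1 then ENNReal.ofReal ρ else ENNReal.ofReal δ ^ n with hg
  have hterm : ∀ d, ‖MvPowerSeries.coeff d h‖ₑ *
      wsum (cutWeight ρ w (k + 1)) (seriesMonomial (substArgs y) d) ≤
      ‖MvPowerSeries.coeff d h‖ₑ * g d.degree := by
    intro d
    rcases Nat.lt_or_ge d.degree 2 with hd | hd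
    · rcases Nat.lt_or_ge d.degree 1 with hd0 | hd1
      · have : d = 0 := (Finsupp.degree_eq_zero_iff d).1 (by omega)
        rw [this, h0]; simp
      · obtain ⟨i, rfl⟩ := eq_single_of_degree_eq_one (d := d) (by omega)
        rcases i with i | i
        · gcongr
          rw [seriesMonomial_single, pow_one, Finsupp.degree_single]
          simpa [hg, substArgs] using hX (k + 1) i
        · rw [hlin]; simp
    · gcongr
      have h1 : g d.degree = ENNReal.ofReal δ ^ d.degree := by
        simp only [hg]
        rw [if_neg (by omega), if_neg (by omega)]
      rw [h1]
      refine wsum_seriesMonomial_le_of_two_le_degree hW0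
        (fun e e' => cutWeight_add_le hρ hw1 hw e e' fun h => ?_)
        (fun e e' he he' => cutWeight_add_le hρ hw1 hw e e' fun h => ?_) ha hak hd
      · rw [map_add] at h; omega
      · have h1 := mt (Finsupp.degree_eq_zero_iff e).1 he
        have h2 := mt (Finsupp.degree_eq_zero_iff e').1 he'
        rw [map_add] at h; omega
  have hsplit : ∀ d, ‖MvPowerSeries.coeff d h‖ₑ * g d.degree =
      ∑' n, (if d.degree = n then ‖MvPowerSeries.coeff d h‖ₑ else 0) * g n := by
    intro d
    rw [tsum_eq_single d.degree]
    · simp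
    · intro n hn; rw [if_neg hn.symm, zero_mul]
  have hsum : ∑' d, ‖MvPowerSeries.coeff d h‖ₑ * g d.degree ≤
      ∑' n, ENNReal.ofReal (C * R ^ n) * g n := by
    simp_rw [hsplit]
    rw [ENNReal.tsum_comm]
    refine ENNReal.tsum_le_tsum fun n => ?_
    rw [ENNReal.tsum_mul_right]
    gcongr
    exact hh n
  refine (wsum_subst_le _ ha h).trans ((ENNReal.tsum_le_tsum hterm).trans (hsum.trans ?_))
  rw [tsum_eq_zero_add' ENNReal.summable, tsum_eq_zero_add' ENNReal.summable]
  have h2 : ∀ n : ℕ, ENNReal.ofReal (C * R ^ (n + 1 + 1)) * g (n + 1 + 1) ≤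
      ENNReal.ofReal (C * (R * δ) ^ 2 * (1 / 2) ^ n) := by
    intro n
    have h1 : g (n + 1 + 1) = ENNReal.ofReal δ ^ (n + 1 + 1) := by simp [hg]
    rw [h1, ← ENNReal.ofReal_pow hδ.le, ← ENNReal.ofReal_mul (by positivity)]
    apply ENNReal.ofReal_le_ofReal
    calc C * R ^ (n + 1 + 1) * δ ^ (n + 1 + 1) = C * (R * δ) ^ 2 * (R * δ) ^ n := by ring
      _ ≤ _ := by gcongr
  have h3 : ∑' n : ℕ, ENNReal.ofReal (C * (R * δ) ^ 2 * (1 / 2) ^ n) =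
      ENNReal.ofReal (2 * (C * (R * δ) ^ 2)) := by
    rw [← ENNReal.ofReal_tsum_of_nonneg (fun n => by positivity)
      (summable_geometric_two.mul_left _), tsum_mul_left, tsum_geometric_two, mul_comm]
  have h4 := (ENNReal.tsum_le_tsum h2).trans h3.le
  have h5 : ENNReal.ofReal (C * R ^ 0) * g 0 = 0 := by simp [hg]
  have h6 : ENNReal.ofReal (C * R ^ (0 + 1)) * g (0 + 1) = ENNReal.ofReal (C * R * ρ) := by
    rw [ENNReal.ofReal_mul (by positivity : (0 : ℝ) ≤ C * R)]
    simp [hg]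
  rw [h5, h6, zero_add, ENNReal.ofReal_add (by positivity) (by positivity)]
  gcongr

end

/-- The constants are chosen before `w`, `l`, `s` and `y`, so one pair `δ`, `M` serves several
weights. -/
theorem exists_coeff_bound_of_eq_implicitStep (B : Matrix (Fin N) (Fin N) ℂ)
    {h : Fin N → MvPowerSeries (Fin 2 ⊕ Fin N) ℂ} {C R : ℝ} (hC : 0 < C)
    (hR : 0 < R) (h0 : ∀ j, MvPowerSeries.coeff 0 (h j) = 0)
    (hlin : ∀ i j : Fin N, MvPowerSeries.coeff (Finsupp.single (Sum.inr i) 1) (h j) = 0)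
    (hh : ∀ j n, ∑' d, (if d.degree = n then ‖MvPowerSeries.coeff d (h j)‖ₑ else 0) ≤
      ENNReal.ofReal (C * R ^ n)) {K : ℝ} (hK : 0 ≤ K) :
    ∃ δ > (0 : ℝ), ∃ M > (0 : ℝ), ∀ (w : (Fin 2 →₀ ℕ) → ℝ) (l : (Fin 2 →₀ ℕ) → ℂ)
      (s : Fin 2 →₀ ℕ) (y : Fin N → FormalSeries),
      (∀ e, 1 ≤ w e) → (∀ e e', w e * w e' ≤ w (e + e')) → s ≠ 0 →
      (∀ e, ‖l e‖ * w e ≤ K * w (s + e)) →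
      (∀ i, MvPowerSeries.constantCoeff (y i) = 0) → y = implicitStep B l s h y →
      ∀ i e, ‖MvPowerSeries.coeff e (y i)‖ ≤ δ * M ^ e.degree * w e := by
  set b : ℝ := ∑ i, ∑ j, ‖B i j‖ with hb
  have hb0 : 0 ≤ b := by positivity
  -- The two summands of the denominator give `R δ ≤ 1/2` and bound the part of degree at least two
  -- by `δ / 2`.
  set δ : ℝ := 1 / (2 * R + 4 * b * C * R ^ 2) with hδ
  have hδ0 : 0 < δ := by positivity
  -- The first summand of the denominator bounds the shift and the linear terms by `δ / 2`; `1`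
  -- gives `ρ ≤ δ`, and `δ` gives `ρ ≤ 1`.
  set ρ : ℝ := δ / (2 * b * (K * δ + C * R) + 1 + δ) with hρ
  have hρ0 : 0 < ρ := by positivity
  have hX : 0 ≤ 2 * b * (K * δ + C * R) := by positivity
  have hρ1 : ρ ≤ 1 := by rw [hρ, div_le_one (by positivity)]; linarith
  have hρδ : ρ ≤ δ := div_le_self hδ0.le (by linarith)
  have hRδ : R * δ ≤ 1 / 2 := by
    rw [hδ, mul_one_div, div_le_iff₀ (by positivity)]
    have : 0 ≤ b * C * R ^ 2 := by positivity
    linarith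
  have hbδ : b * (2 * (C * (R * δ) ^ 2)) ≤ δ / 2 := by
    have h1 : 4 * b * C * R ^ 2 * δ ≤ 1 := by
      rw [hδ, mul_one_div, div_le_one (by positivity)]; linarith
    have h2 := mul_le_mul_of_nonneg_right h1 hδ0.le
    nlinarith
  have hbρ : b * (K * ρ * δ + C * R * ρ) ≤ δ / 2 := by
    have h1 : ρ * (2 * b * (K * δ + C * R) + 1 + δ) = δ := by
      rw [hρ]; field_simp
    nlinarith [mul_pos hρ0 hδ0]
  refine ⟨δ, hδ0, ρ⁻¹, by positivity, fun w l s y hw1 hw hs hl hy hfix => ?_⟩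
  have key : ∀ k i, wsum (cutWeight ρ w k) (y i) ≤ ENNReal.ofReal δ := by
    intro k
    induction k with
    | zero =>
      intro i
      refine le_trans (le_of_eq (ENNReal.tsum_eq_zero.2 fun e => ?_)) zero_le
      rw [cutWeight]
      split_ifs with he
      · rw [(Finsupp.degree_eq_zero_iff e).1 (by omega),
          MvPowerSeries.coeff_zero_eq_constantCoeff_apply, hy]
        simp
      · simp
    | succ k ih =>
      intro i
      rw [hfix, implicitStep]
      refine (wsum_sum_le _ _ _).trans ?_
      have hj : ∀ j ∈ (Finset.univ : Finset (Fin N)), wsum (cutWeight ρ w (k + 1)) (B i j •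
          (MvPowerSeries.monomial s 1 * diagOp l (y j) -
            MvPowerSeries.subst (substArgs y) (h j))) ≤
          ENNReal.ofReal (‖B i j‖ *
            (K * ρ * δ + (C * R * ρ + 2 * (C * (R * δ) ^ 2)))) := by
        intro j _
        rw [wsum_smul, ENNReal.ofReal_mul (norm_nonneg _), ofReal_norm,
          ENNReal.ofReal_add (by positivity) (by positivity)]
        gcongr
        refine (wsum_sub_le _ _ _).trans (add_le_add ?_
          (wsum_subst_cutWeight_le hρ0 hw1 hw hC hR (h0 j) (fun i => hlin i j) (hh j) hδ0 hρδ hRδ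
            hy ih))
        refine (wsum_monomial_mul_diagOp_le hρ0 hw1 hρ1 hK hs hl k (y j)).trans ?_
        rw [ENNReal.ofReal_mul (by positivity : 0 ≤ K * ρ)]
        gcongr
        exact ih j
      refine (Finset.sum_le_sum hj).trans ?_
      rw [← ENNReal.ofReal_sum_of_nonneg (fun j _ => by positivity), ← Finset.sum_mul]
      apply ENNReal.ofReal_le_ofReal
      have hbi : ∑ j, ‖B i j‖ ≤ b :=
        Finset.single_le_sum (f := fun i => ∑ j, ‖B i j‖)
          (fun i _ => Finset.sum_nonneg fun j _ => norm_nonneg _) (Finset.mem_univ i)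
      calc _ ≤ b * (K * ρ * δ + (C * R * ρ + 2 * (C * (R * δ) ^ 2))) := by gcongr
        _ ≤ δ := by linarith
  intro i e
  -- The bound is uniform in the cut-off, so cutting at `|e|` itself suffices to read off the
  -- coefficient at `e`.
  have h1 := (enorm_coeff_mul_le_wsum (cutWeight ρ w e.degree) (y i) e).trans (key e.degree i)
  have hwe := zero_lt_one.trans_le (hw1 e)
  rw [cutWeight, if_pos le_rfl, ← ofReal_norm, ← ENNReal.ofReal_mul (norm_nonneg _),
    ENNReal.ofReal_le_ofReal_iff hδ0.le, ← mul_div_assoc, div_le_iff₀ hwe] at h1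
  have h2 : δ * ρ⁻¹ ^ e.degree * w e = (δ * w e) / ρ ^ e.degree := by
    rw [inv_pow, div_eq_mul_inv]; ring
  rw [h2, le_div_iff₀ (by positivity)]
  exact h1
end

/-! ### From the two `q`-equations to the fixed point, and from coefficients to discs -/

section
variable {N : ℕ}

theorem holomorphicBoundedBy_of_norm_le {c : ℕ → Fin N → ℂ} {R B t B' : ℝ} (hB : 0 ≤ B)
    (ht : 0 ≤ t) (htR : t * R ≤ 1 / 2) (hc : ∀ m, ‖c m‖ ≤ B * t ^ m) (hB' : 2 * B ≤ B') :
    HolomorphicBoundedBy c R B' := by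
  have hbd : ∀ (m : ℕ) (z : ℂ), ‖z‖ ≤ R → ‖z ^ m • c m‖ ≤ B * (1 / 2) ^ m := by
    intro m z hz
    rw [norm_smul, norm_pow]
    calc ‖z‖ ^ m * ‖c m‖ ≤ ‖z‖ ^ m * (B * t ^ m) := by gcongr; exact hc m
      _ = B * (t * ‖z‖) ^ m := by ring
      _ ≤ B * (1 / 2) ^ m := by
        gcongr
        exact (mul_le_mul_of_nonneg_left hz ht).trans htR
  have hs : Summable fun m : ℕ => B * (1 / 2 : ℝ) ^ m := summable_geometric_two.mul_left B
  have hsum : ∑' m : ℕ, B * (1 / 2 : ℝ) ^ m = 2 * B := by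
    rw [tsum_mul_left, tsum_geometric_two, mul_comm]
  refine ⟨fun z => ∑' m, z ^ m • c m, ?_, fun z hz => ⟨?_, ?_⟩⟩
  · refine Complex.differentiableOn_tsum_of_summable_norm hs (fun m => ?_) Metric.isOpen_ball
      fun m z hz => hbd m z ?_
    · exact ((differentiable_id.pow m).smul_const (c m)).differentiableOn
    · rw [mem_ball_zero_iff] at hz; exact hz.le
  · exact (Summable.of_norm_bounded hs fun m => hbd m z hz).hasSum
  · exact (tsum_of_norm_bounded hs.hasSum fun m => hbd m z hz).trans (hsum.le.trans hB')

/-- The exponent of `x ^ p * ε ^ α`. -/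
def prefactorExp (p α : ℕ) : Fin 2 →₀ ℕ := Finsupp.single 0 p + Finsupp.single 1 α

theorem prefactorExp_ne_zero {p α : ℕ} (hα : 1 ≤ α) : prefactorExp p α ≠ 0 := by
  intro h
  have := DFunLike.congr_fun h 1
  simp [prefactorExp] at this
  omega

theorem X_pow_mul_X_pow_eq_monomial (p α : ℕ) :
    (MvPowerSeries.X 1 : FormalSeries) ^ α * (MvPowerSeries.X 0) ^ p =
      MvPowerSeries.monomial (prefactorExp p α) 1 := by
  rw [MvPowerSeries.X_pow_eq, MvPowerSeries.X_pow_eq, MvPowerSeries.monomial_mul_monomial,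
    mul_one, add_comm]
  rfl

theorem coeff_qDeriv (q : ℂ) (f : FormalSeries) (e : Fin 2 →₀ ℕ) :
    MvPowerSeries.coeff e (qDeriv q f) =
      qNumber q (e 0 + 1) * MvPowerSeries.coeff (e + Finsupp.single 0 1) f := rfl

/-- One of the `p + 1` factors `x` makes the Jackson derivative diagonal, so both equations share
the prefactor `x^p ε^α`. Exponents without `x` are covered by `[0]_q = 0`. -/
theorem X_mul_qDeriv (q : ℂ) (f : FormalSeries) :
    MvPowerSeries.X 0 * qDeriv q f = diagOp (fun e => qNumber q (e 0)) f := by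
  ext e
  rw [MvPowerSeries.X, MvPowerSeries.coeff_monomial_mul, coeff_diagOp, one_mul]
  split_ifs with h
  · have h1 : 1 ≤ e 0 := by simpa using h
    rw [coeff_qDeriv, tsub_add_cancel_of_le h, Finsupp.tsub_apply, Finsupp.single_eq_same,
      Nat.sub_add_cancel h1]
  · have h1 : e 0 = 0 := by
      by_contra h2
      exact h (by simpa [Nat.one_le_iff_ne_zero] using h2)
    rw [h1]
    simp [qNumber]

theorem isFormalSolutionDeriv_iff (q : ℂ) (p α : ℕ) (F : ℂ × ℂ × (Fin N → ℂ) → (Fin N → ℂ))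
    (y : Fin N → FormalSeries) :
    IsFormalSolutionDeriv q p α F y ↔ (∀ j, MvPowerSeries.constantCoeff (y j) = 0) ∧
      ∀ j, MvPowerSeries.monomial (prefactorExp p α) 1 * diagOp (fun e => qNumber q (e 0)) (y j) =
        formalComp F y j := by
  simp_rw [IsFormalSolutionDeriv, ← X_mul_qDeriv, ← X_pow_mul_X_pow_eq_monomial, pow_succ,
    mul_assoc]

theorem isFormalSolutionShift_iff (q : ℂ) (p α : ℕ) (F : ℂ × ℂ × (Fin N → ℂ) → (Fin N → ℂ))
    (y : Fin N → FormalSeries) :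
    IsFormalSolutionShift q p α F y ↔ (∀ j, MvPowerSeries.constantCoeff (y j) = 0) ∧
      ∀ j, MvPowerSeries.monomial (prefactorExp p α) 1 * diagOp (fun e => q ^ e 0) (y j) =
        formalComp F y j := by
  simp_rw [IsFormalSolutionShift, X_pow_mul_X_pow_eq_monomial]
  rfl

theorem forall_eq_add_sum_smul_iff {V : Type*} [AddCommGroup V] [Module ℂ V]
    {A B : Matrix (Fin N) (Fin N) ℂ} (hAB : A * B = 1) (hBA : B * A = 1) (m s y : Fin N → V) :
    (∀ j, m j = s j + ∑ i, A j i • y i) ↔ y = fun i => ∑ j, B i j • (m j - s j) := by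
  have key : ∀ {P Q : Matrix (Fin N) (Fin N) ℂ}, P * Q = 1 → ∀ (z : Fin N → V) i,
      ∑ j, P i j • ∑ k, Q j k • z k = z i := by
    intro P Q hPQ z i
    simp_rw [Finset.smul_sum, smul_smul]
    rw [Finset.sum_comm]
    simp_rw [← Finset.sum_smul]
    have h : ∀ k, ∑ j, P i j * Q j k = (1 : Matrix (Fin N) (Fin N) ℂ) i k := fun k => by
      rw [← hPQ, Matrix.mul_apply]
    simp [h, Matrix.one_apply]
  constructor
  · intro h
    funext i
    simp_rw [h, add_sub_cancel_left]
    exact (key hBA y i).symm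
  · intro h j
    rw [h, key hAB]
    abel

/-- The Taylor series of the components of `F`, without their linear part in `y`. -/
def nonlinearPart (F : ℂ × ℂ × (Fin N → ℂ) → (Fin N → ℂ)) (j : Fin N) :
    MvPowerSeries (Fin 2 ⊕ Fin N) ℂ :=
  open Classical in
  fun d => if ∃ i : Fin N, d = Finsupp.single (Sum.inr i) 1 then 0 else
    MvPowerSeries.coeff d (taylorSeries fun z => F z j)

theorem coeff_nonlinearPart_of_ne (F : ℂ × ℂ × (Fin N → ℂ) → (Fin N → ℂ)) (j : Fin N)
    {d : Fin 2 ⊕ Fin N →₀ ℕ} (hd : ∀ i : Fin N, d ≠ Finsupp.single (Sum.inr i) 1) :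
    MvPowerSeries.coeff d (nonlinearPart F j) =
      MvPowerSeries.coeff d (taylorSeries fun z => F z j) :=
  if_neg (by simpa using hd)

theorem coeff_single_nonlinearPart (F : ℂ × ℂ × (Fin N → ℂ) → (Fin N → ℂ)) (i j : Fin N) :
    MvPowerSeries.coeff (Finsupp.single (Sum.inr i) 1) (nonlinearPart F j) = 0 :=
  if_pos ⟨i, rfl⟩

theorem coeff_zero_nonlinearPart {F : ℂ × ℂ × (Fin N → ℂ) → (Fin N → ℂ)} (hF0 : F 0 = 0)
    (j : Fin N) : MvPowerSeries.coeff 0 (nonlinearPart F j) = 0 := by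
  rw [coeff_nonlinearPart_of_ne, coeff_zero_taylorSeries, hF0]
  · rfl
  · intro i h
    have := DFunLike.congr_fun h (Sum.inr i)
    simp at this

theorem enorm_coeff_nonlinearPart_le (F : ℂ × ℂ × (Fin N → ℂ) → (Fin N → ℂ)) (j : Fin N)
    (d : Fin 2 ⊕ Fin N →₀ ℕ) : ‖MvPowerSeries.coeff d (nonlinearPart F j)‖ₑ ≤
      ‖MvPowerSeries.coeff d (taylorSeries fun z => F z j)‖ₑ := by
  by_cases h : ∃ i : Fin N, d = Finsupp.single (Sum.inr i) 1
  · obtain ⟨i, rfl⟩ := h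
    rw [coeff_single_nonlinearPart]; simp
  · rw [coeff_nonlinearPart_of_ne F j (by simpa using h)]

/-- The matrix of `D_y F(0, 0, 0)`. -/
def jacobianMatrix (F : ℂ × ℂ × (Fin N → ℂ) → (Fin N → ℂ)) : Matrix (Fin N) (Fin N) ℂ :=
  LinearMap.toMatrix' (fderiv ℂ (fun y : Fin N → ℂ => F (0, 0, y)) 0 : (Fin N → ℂ) →ₗ[ℂ] _)

theorem coeff_single_taylorSeries_eq_jacobianMatrix {F : ℂ × ℂ × (Fin N → ℂ) → (Fin N → ℂ)}
    (hF : AnalyticAt ℂ F 0) (i j : Fin N) :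
    MvPowerSeries.coeff (Finsupp.single (Sum.inr i) 1) (taylorSeries fun z => F z j) =
      jacobianMatrix F j i := by
  rw [coeff_single_taylorSeries]
  have h1 : HasFDerivAt F (fderiv ℂ F 0) 0 := hF.differentiableAt.hasFDerivAt
  have h2 : HasFDerivAt (fun z => F z j) _ 0 := hasFDerivAt_pi'.1 h1 j
  have h3 : HasFDerivAt (fun y : Fin N → ℂ => ((0 : ℂ), (0 : ℂ), y))
      ((ContinuousLinearMap.inr ℂ ℂ (ℂ × (Fin N → ℂ))).comp
        (ContinuousLinearMap.inr ℂ ℂ (Fin N → ℂ))) 0 :=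
    ((ContinuousLinearMap.inr ℂ ℂ (ℂ × (Fin N → ℂ))).comp
        (ContinuousLinearMap.inr ℂ ℂ (Fin N → ℂ))).hasFDerivAt
  have h4 : HasFDerivAt (fun y : Fin N → ℂ => F (0, 0, y)) _ 0 := HasFDerivAt.comp 0 h1 h3
  rw [h2.fderiv, jacobianMatrix, LinearMap.toMatrix'_apply, h4.fderiv]
  simp [stdVec]

theorem taylorSeries_eq_nonlinearPart_add {F : ℂ × ℂ × (Fin N → ℂ) → (Fin N → ℂ)}
    (hF : AnalyticAt ℂ F 0) (j : Fin N) :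
    taylorSeries (fun z => F z j) = nonlinearPart F j +
      ∑ i, jacobianMatrix F j i • MvPowerSeries.X (Sum.inr i) := by
  classical
  ext d
  rw [map_add, map_sum]
  simp_rw [map_smul, MvPowerSeries.coeff_X]
  by_cases h : ∃ i : Fin N, d = Finsupp.single (Sum.inr i) 1
  · obtain ⟨i, rfl⟩ := h
    rw [coeff_single_nonlinearPart, coeff_single_taylorSeries_eq_jacobianMatrix hF,
      Finset.sum_eq_single i]
    · simp
    · intro k _ hk
      rw [if_neg, smul_zero]
      rw [Finsupp.single_left_inj one_ne_zero]
      simpa using hk.symm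
    · simp
  · push Not at h
    rw [coeff_nonlinearPart_of_ne F j h, Finset.sum_eq_zero, add_zero]
    intro i _
    rw [if_neg (h i), smul_zero]

theorem formalComp_eq {F : ℂ × ℂ × (Fin N → ℂ) → (Fin N → ℂ)}
    (hF : AnalyticAt ℂ F 0) {y : Fin N → FormalSeries}
    (hy : ∀ i, MvPowerSeries.constantCoeff (y i) = 0) (j : Fin N) :
    formalComp F y j = MvPowerSeries.subst (substArgs y) (nonlinearPart F j) +
      ∑ i, jacobianMatrix F j i • y i := by
  have hs := MvPowerSeries.hasSubst_of_constantCoeff_zero (constantCoeff_substArgs hy)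
  rw [formalComp, taylorSeries_eq_nonlinearPart_add hF, ← substArgs,
    ← MvPowerSeries.coe_substAlgHom hs, map_add, map_sum]
  simp_rw [map_smul, MvPowerSeries.substAlgHom_X]
  rfl

theorem exists_inverse_jacobianMatrix {F : ℂ × ℂ × (Fin N → ℂ) → (Fin N → ℂ)}
    (hDF : IsUnit (fderiv ℂ (fun y : Fin N → ℂ => F (0, 0, y)) 0)) :
    ∃ B, jacobianMatrix F * B = 1 ∧ B * jacobianMatrix F = 1 := by
  obtain ⟨u, hu⟩ := hDF
  refine ⟨LinearMap.toMatrix' ((u⁻¹ : ((Fin N → ℂ) →L[ℂ] (Fin N → ℂ))ˣ) :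
    (Fin N → ℂ) →L[ℂ] (Fin N → ℂ)).toLinearMap, ?_, ?_⟩
  · rw [jacobianMatrix, ← LinearMap.toMatrix'_mul, ← hu, ← ContinuousLinearMap.toLinearMap_mul]
    simp
  · rw [jacobianMatrix, ← LinearMap.toMatrix'_mul, ← hu, ← ContinuousLinearMap.toLinearMap_mul]
    simp

theorem formalEquation_iff {F : ℂ × ℂ × (Fin N → ℂ) → (Fin N → ℂ)}
    (hF : AnalyticAt ℂ F 0) {B : Matrix (Fin N) (Fin N) ℂ} (hAB : jacobianMatrix F * B = 1)
    (hBA : B * jacobianMatrix F = 1) (l : (Fin 2 →₀ ℕ) → ℂ) (s : Fin 2 →₀ ℕ)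
    (y : Fin N → FormalSeries) :
    ((∀ j, MvPowerSeries.constantCoeff (y j) = 0) ∧
      ∀ j, MvPowerSeries.monomial s 1 * diagOp l (y j) = formalComp F y j) ↔
    ((∀ j, MvPowerSeries.constantCoeff (y j) = 0) ∧
      y = implicitStep B l s (nonlinearPart F) y) := by
  refine and_congr_right fun hy => ?_
  simp_rw [formalComp_eq hF hy]
  exact forall_eq_add_sum_smul_iff hAB hBA _ _ _

theorem exists_tsum_nonlinearPart_le {F : ℂ × ℂ × (Fin N → ℂ) → (Fin N → ℂ)}
    (hF : AnalyticAt ℂ F 0) : ∃ C > (0 : ℝ), ∃ R > (0 : ℝ), ∀ j n,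
      ∑' d, (if d.degree = n then ‖MvPowerSeries.coeff d (nonlinearPart F j)‖ₑ else 0) ≤
      ENNReal.ofReal (C * R ^ n) := by
  have hFj : ∀ j, AnalyticAt ℂ (fun z => F z j) 0 := fun j => analyticAt_pi_iff.1 hF j
  choose C hC R hR h using fun j => (hFj j).exists_norm_iteratedFDeriv_le
  have hC0 : 0 ≤ ∑ j, C j := Finset.sum_nonneg fun j _ => (hC j).le
  have hR0 : 0 ≤ ∑ j, R j := Finset.sum_nonneg fun j _ => (hR j).le
  refine ⟨∑ j, C j + 1, by positivity, (2 + N : ℕ) * (∑ j, R j + 1), by positivity,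
    fun j n => ?_⟩
  refine le_trans (ENNReal.tsum_le_tsum fun d => ?_)
    (tsum_enorm_coeff_taylorSeries_le (fun z => F z j) (fun n v hv => (h j n v hv).trans ?_) n)
  · split_ifs
    · exact enorm_coeff_nonlinearPart_le F j d
    · exact le_rfl
  · have h1 : C j ≤ ∑ j, C j + 1 :=
      (Finset.single_le_sum (fun j _ => (hC j).le) (Finset.mem_univ j)).trans (by linarith)
    have h2 : R j ≤ ∑ j, R j + 1 :=
      (Finset.single_le_sum (fun j _ => (hR j).le) (Finset.mem_univ j)).trans (by linarith)
    have := (hR j).le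
    gcongr

/-! ### The two weights and the resulting bounds -/

theorem norm_qNumber_le {q : ℂ} (hq : 1 < ‖q‖) (n : ℕ) :
    ‖qNumber q n‖ ≤ (1 + 2 / ‖q - 1‖) * ‖q‖ ^ n := by
  have h1 : 1 ≤ ‖q‖ ^ n := one_le_pow₀ hq.le
  have h2 : ‖q ^ n - 1‖ ≤ 2 * ‖q‖ ^ n := by
    refine (norm_sub_le _ _).trans ?_
    rw [norm_pow, norm_one]; linarith
  rw [qNumber, norm_div]
  calc ‖q ^ n - 1‖ / ‖q - 1‖ ≤ 2 * ‖q‖ ^ n / ‖q - 1‖ := by gcongr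
    _ = 2 / ‖q - 1‖ * ‖q‖ ^ n := by ring
    _ ≤ _ := by gcongr; linarith

/-- The two families of coefficient bounds for solutions of either equation. -/
theorem exists_coeff_bounds {q : ℂ} (hq : 1 < ‖q‖) {p α : ℕ} (hα : 1 ≤ α)
    {F : ℂ × ℂ × (Fin N → ℂ) → (Fin N → ℂ)} (hF : AnalyticAt ℂ F 0) (hF0 : F 0 = 0)
    {B : Matrix (Fin N) (Fin N) ℂ} {l : (Fin 2 →₀ ℕ) → ℂ} {K : ℝ} (hK : 0 ≤ K)
    (hl : ∀ e, ‖l e‖ ≤ K * ‖q‖ ^ e 0) {y : Fin N → FormalSeries}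
    (hy0 : ∀ j, MvPowerSeries.constantCoeff (y j) = 0)
    (hy : y = implicitStep B l (prefactorExp p α) (nonlinearPart F) y) :
    ∃ δ > (0 : ℝ), ∃ M > (0 : ℝ), ∀ i n m,
      ‖biCoeff n m (y i)‖ ≤ δ * M ^ (n + m) * ‖q‖ ^ (n * (m / α)) ∧
      (0 < p → ‖biCoeff n m (y i)‖ ≤
        δ * M ^ (n + m) * ‖q‖ ^ ((n : ℝ) ^ 2 / (2 * (p : ℝ)))) := by
  obtain ⟨C, hC, R, hR, hh⟩ := exists_tsum_nonlinearPart_le hF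
  obtain ⟨δ, hδ, M, hM, h⟩ := exists_coeff_bound_of_eq_implicitStep B hC hR
    (coeff_zero_nonlinearPart hF0) (coeff_single_nonlinearPart F) hh hK
  have hs0 : (prefactorExp p α) 0 = p := by simp [prefactorExp]
  have hs1 : (prefactorExp p α) 1 = α := by simp [prefactorExp]
  have hq0 : 0 < ‖q‖ := by linarith
  refine ⟨δ, hδ, M, hM, fun i n m => ⟨?_, fun hp => ?_⟩⟩
  · have := h (fun e => ‖q‖ ^ (e 0 * (e 1 / α))) l (prefactorExp p α) y
      (fun e => one_le_pow₀ hq.le) (fun e e' => ?_) (prefactorExp_ne_zero hα) (fun e => ?_)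
      hy0 hy i (Finsupp.single 0 n + Finsupp.single 1 m)
    · simpa [biCoeff] using this
    · rw [← pow_add]
      refine pow_le_pow_right₀ hq.le ?_
      rw [Finsupp.add_apply, Finsupp.add_apply, add_mul]
      gcongr <;> omega
    -- Adding `α` to `m` raises `⌊m/α⌋` by exactly one, which yields the factor `|q|^n`; adding `p`
    -- to `n` only helps.
    · rw [Finsupp.add_apply, Finsupp.add_apply, hs0, hs1, Nat.add_div_left _ (by omega)]
      calc ‖l e‖ * ‖q‖ ^ (e 0 * (e 1 / α))
          ≤ K * ‖q‖ ^ e 0 * ‖q‖ ^ (e 0 * (e 1 / α)) := by gcongr; exact hl e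
        _ = K * ‖q‖ ^ (e 0 * (e 1 / α).succ) := by
          rw [mul_assoc, ← pow_add, Nat.mul_succ, add_comm]
        _ ≤ _ := by gcongr; exacts [hq.le, by omega]
  · have hp' : (0 : ℝ) < p := by exact_mod_cast hp
    have := h (fun e => ‖q‖ ^ ((e 0 : ℝ) ^ 2 / (2 * (p : ℝ)))) l (prefactorExp p α) y
      (fun e => Real.one_le_rpow hq.le (by positivity)) (fun e e' => ?_)
      (prefactorExp_ne_zero hα) (fun e => ?_)
      hy0 hy i (Finsupp.single 0 n + Finsupp.single 1 m)
    · simpa [biCoeff] using this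
    · rw [← Real.rpow_add hq0]
      refine Real.rpow_le_rpow_of_exponent_le hq.le ?_
      rw [← add_div, Finsupp.add_apply]
      push_cast
      gcongr
      have : (0 : ℝ) ≤ (e 0 : ℝ) * e' 0 := by positivity
      nlinarith
    -- Here `(n + p)²/(2p) = n²/(2p) + n + p/2`: the middle term pays for `|q|^n`, and this fixes
    -- the constant `1/(2p)`.
    · rw [Finsupp.add_apply, hs0]
      calc ‖l e‖ * ‖q‖ ^ ((e 0 : ℝ) ^ 2 / (2 * (p : ℝ)))
          ≤ K * ‖q‖ ^ e 0 * ‖q‖ ^ ((e 0 : ℝ) ^ 2 / (2 * (p : ℝ))) := by gcongr; exact hl e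
        _ = K * ‖q‖ ^ ((e 0 : ℝ) + (e 0 : ℝ) ^ 2 / (2 * (p : ℝ))) := by
          rw [mul_assoc, Real.rpow_add hq0, Real.rpow_natCast]
        _ ≤ _ := by
          gcongr
          · exact hq.le
          · push_cast
            rw [le_div_iff₀ (by positivity), add_mul, div_mul_cancel₀ _ (by positivity)]
            nlinarith

/-- With `n` now the power of `ε`, the exponent `m ⌊n/α⌋` is linear in the power `m` of `x`, so the
floor survives in the radius. -/
theorem holomorphicBoundedBy_epsCoeff {q : ℂ} (hq : 1 < ‖q‖) {α : ℕ} {y : Fin N → FormalSeries}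
    {δ M : ℝ} (hδ : 0 < δ) (hM : 0 < M)
    (h : ∀ i n m, ‖biCoeff n m (y i)‖ ≤ δ * M ^ (n + m) * ‖q‖ ^ (n * (m / α))) (n : ℕ) :
    HolomorphicBoundedBy (epsCoeff y n) (1 / (2 * M) / ‖q‖ ^ (n / α)) (2 * δ * M ^ n) := by
  have hq0 : 0 < ‖q‖ := by linarith
  refine holomorphicBoundedBy_of_norm_le (B := δ * M ^ n) (t := M * ‖q‖ ^ (n / α))
    (by positivity) (by positivity) (le_of_eq (by field_simp)) (fun m => ?_)
    (le_of_eq (by ring))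
  rw [pi_norm_le_iff_of_nonneg (by positivity)]
  intro i
  refine (h i m n).trans (le_of_eq ?_)
  rw [mul_pow, ← pow_mul, mul_comm m (n / α), pow_add]
  ring

theorem holomorphicBoundedBy_xCoeff_of_rpow {q : ℂ} (hq : 1 < ‖q‖) {p : ℕ}
    {y : Fin N → FormalSeries} {δ M : ℝ} (hδ : 0 < δ) (hM : 0 < M)
    (h : ∀ i n m, ‖biCoeff n m (y i)‖ ≤
      δ * M ^ (n + m) * ‖q‖ ^ ((n : ℝ) ^ 2 / (2 * (p : ℝ)))) (n : ℕ) :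
    HolomorphicBoundedBy (xCoeff y n) (1 / (2 * M))
      (2 * δ * M ^ n * ‖q‖ ^ ((n : ℝ) ^ 2 / (2 * (p : ℝ)))) := by
  have hq0 : 0 < ‖q‖ := by linarith
  refine holomorphicBoundedBy_of_norm_le
    (B := δ * M ^ n * ‖q‖ ^ ((n : ℝ) ^ 2 / (2 * (p : ℝ)))) (t := M)
    (by positivity) (by positivity) (le_of_eq (by field_simp)) (fun m => ?_)
    (le_of_eq (by ring))
  rw [pi_norm_le_iff_of_nonneg (by positivity)]
  intro i
  refine (h i n m).trans (le_of_eq ?_)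
  ring

/-- Here the floor falls on the summation index `m`; replacing `⌊m/α⌋` by `m/α` makes the bound
geometric in `m`, which is why the radius has the exponent `n/α` without floor. -/
theorem holomorphicBoundedBy_xCoeff_of_floor {q : ℂ} (hq : 1 < ‖q‖) {α : ℕ}
    {y : Fin N → FormalSeries} {δ M : ℝ} (hδ : 0 < δ) (hM : 0 < M)
    (h : ∀ i n m, ‖biCoeff n m (y i)‖ ≤ δ * M ^ (n + m) * ‖q‖ ^ (n * (m / α))) (n : ℕ) :
    HolomorphicBoundedBy (xCoeff y n) (1 / (2 * M) / ‖q‖ ^ ((n : ℝ) / (α : ℝ)))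
      (2 * δ * M ^ n) := by
  have hq0 : 0 < ‖q‖ := by linarith
  refine holomorphicBoundedBy_of_norm_le (B := δ * M ^ n) (t := M * ‖q‖ ^ ((n : ℝ) / (α : ℝ)))
    (by positivity) (by positivity) (le_of_eq (by field_simp)) (fun m => ?_)
    (le_of_eq (by ring))
  rw [pi_norm_le_iff_of_nonneg (by positivity)]
  intro i
  refine (h i n m).trans ?_
  have h1 : ‖q‖ ^ (n * (m / α)) ≤ (‖q‖ ^ ((n : ℝ) / (α : ℝ))) ^ m := by
    rw [← Real.rpow_mul_natCast hq0.le, ← Real.rpow_natCast]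
    refine Real.rpow_le_rpow_of_exponent_le hq.le ?_
    push_cast
    calc (n : ℝ) * ((m / α : ℕ) : ℝ) ≤ n * ((m : ℝ) / α) := by gcongr; exact Nat.cast_div_le
      _ = _ := by ring
  calc δ * M ^ (n + m) * ‖q‖ ^ (n * (m / α))
      ≤ δ * M ^ (n + m) * (‖q‖ ^ ((n : ℝ) / (α : ℝ))) ^ m := by gcongr
    _ = _ := by ring

end
end

theorem theorem1 (q : ℂ) (hq : 1 < ‖q‖) (N p α : ℕ) (hα : 1 ≤ α)
    (F : ℂ × ℂ × (Fin N → ℂ) → (Fin N → ℂ))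
    (hF : AnalyticAt ℂ F 0) (hF0 : F 0 = 0)
    (hDF : IsUnit (fderiv ℂ (fun y : Fin N → ℂ => F (0, 0, y)) 0)) :
    (∃! y : Fin N → FormalSeries, IsFormalSolutionDeriv q p α F y) ∧
    (∃! y : Fin N → FormalSeries, IsFormalSolutionShift q p α F y) ∧
    ∀ y : Fin N → FormalSeries,
      (IsFormalSolutionDeriv q p α F y ∨ IsFormalSolutionShift q p α F y) →
      (0 < p → ∃ r > (0 : ℝ), ∃ C > (0 : ℝ), ∃ A > (0 : ℝ), ∀ n : ℕ,
        HolomorphicBoundedBy (xCoeff y n) r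
          (C * A ^ n * ‖q‖ ^ ((n : ℝ) ^ 2 / (2 * (p : ℝ)))) ∧
        HolomorphicBoundedBy (epsCoeff y n) (r / ‖q‖ ^ (n / α)) (C * A ^ n)) ∧
      (p = 0 → ∃ r > (0 : ℝ), ∃ C > (0 : ℝ), ∃ A > (0 : ℝ), ∀ n : ℕ,
        HolomorphicBoundedBy (xCoeff y n) (r / ‖q‖ ^ ((n : ℝ) / (α : ℝ))) (C * A ^ n) ∧
        HolomorphicBoundedBy (epsCoeff y n) (r / ‖q‖ ^ (n / α)) (C * A ^ n)) := by
  obtain ⟨B, hAB, hBA⟩ := exists_inverse_jacobianMatrix hDF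
  simp_rw [isFormalSolutionDeriv_iff, isFormalSolutionShift_iff, formalEquation_iff hF hAB hBA]
  refine ⟨existsUnique_implicitStep B _ (prefactorExp_ne_zero hα)
      (coeff_zero_nonlinearPart hF0) (coeff_single_nonlinearPart F),
    existsUnique_implicitStep B _ (prefactorExp_ne_zero hα)
      (coeff_zero_nonlinearPart hF0) (coeff_single_nonlinearPart F), fun y hy => ?_⟩
  obtain ⟨δ, hδ, M, hM, h⟩ : ∃ δ > (0 : ℝ), ∃ M > (0 : ℝ), ∀ i n m,
      ‖biCoeff n m (y i)‖ ≤ δ * M ^ (n + m) * ‖q‖ ^ (n * (m / α)) ∧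
      (0 < p → ‖biCoeff n m (y i)‖ ≤
        δ * M ^ (n + m) * ‖q‖ ^ ((n : ℝ) ^ 2 / (2 * (p : ℝ)))) := by
    rcases hy with ⟨hy0, hy⟩ | ⟨hy0, hy⟩
    · exact exists_coeff_bounds hq hα hF hF0 (by positivity)
        (fun e => norm_qNumber_le hq (e 0)) hy0 hy
    · exact exists_coeff_bounds hq hα hF hF0 zero_le_one
        (fun e => by rw [norm_pow, one_mul]) hy0 hy
  have heps := holomorphicBoundedBy_epsCoeff hq hδ hM fun i n m => (h i n m).1
  refine ⟨fun hp => ⟨1 / (2 * M), by positivity, 2 * δ, by positivity, M, hM, fun n =>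
      ⟨holomorphicBoundedBy_xCoeff_of_rpow hq hδ hM (fun i n m => (h i n m).2 hp) n, heps n⟩⟩,
    fun _ => ⟨1 / (2 * M), by positivity, 2 * δ, by positivity, M, hM, fun n =>
      ⟨holomorphicBoundedBy_xCoeff_of_floor hq hδ hM (fun i n m => (h i n m).1) n, heps n⟩⟩⟩
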